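/- All spaces are compactly generated Hausdorff, and products carry the compactly generated topology. Let $K_n$ ($n\ge 0$) be the space of metric trees with $n$ leaves: planar rooted trees, all of whose vertices have at least two incoming edges, with a length in $[0,1]$ on each internal edge, modulo collapsing internal edges of length $0$ (with the quotient topology); $K_0=\{\delta_0\}$ and $K_1$ are points. For $\rho\in K_n$, $\tau\in K_m$, $1\le i\le n$, let $\rho\circ_i\tau\in K_{n+m-1}$ be obtained by grafting the root of $\tau$ to the $i$-th leaf of $\rho$, the new internal edge having length $1$; the point of $K_1$ is the identity for this operation, and $\rho\circ_i\delta_0$ is $\rho$ with its $i$-th leaf erased (a vertex left with one incoming edge is removed; if both edges at it are internal, of lengths $\alpha,\beta$, they become one edge of length $\max\{\alpha,\beta\}$, and otherwise they become an external edge). Let $\delta_2$ denote the tree with one vertex and two leaves. Let $X$ be an $A_\infty$-space, i.e. an algebra over the operad $\{K_n\}_{n\ge0}$, with structure maps $M_n:K_n\times X^n\to X$ and unit $e=M_0(\delta_0)$. Let $X$ act on a space $P$ by a left $A_\infty$-action with structure maps $N_n:K_n\times X^{n-1}\times P\to P$ ($n\ge1$), i.e. these maps are continuous, $N_1=\mathrm{id}_P$,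 and with $k=|\rho|+|\tau|-1$, $$N_k(\rho\circ_j\tau;x_1,\dots,x_{k-1},p)=N_{|\rho|}(\rho;x_1,\dots,x_{j-1},M_{|\tau|}(\tau;x_j,\dots,x_{j+|\tau|-1}),x_{j+|\tau|},\dots,x_{k-1},p)\quad(1\le j<|\rho|,\ |\tau|\ge0),$$ $$N_k(\rho\circ_{|\rho|}\tau;x_1,\dots,x_{k-1},p)=N_{|\rho|}(\rho;x_1,\dots,x_{|\rho|-1},N_{|\tau|}(\tau;x_{|\rho|},\dots,x_{k-1},p))\quad(|\tau|\ge1).$$ The two-sided bar construction $B(X,X,P)$ is the quotient of $\coprod_{n\ge0}K_{n+2}\times X\times X^{n}\times P$ by the relation generated, for $|\tau|\ge1$, by $$(\rho\circ_{i+1}\tau;x_0,\dots,x_{n+1})\equiv(\rho;x_0,\dots,x_{i-1},E(\tau;x_i,\dots,x_{i+|\tau|-1}),x_{i+|\tau|},\dots,x_{n+1}),\qquad 0\le i\le|\rho|-1,$$ where $x_{n+1}\in P$, $x_0,\dots,x_n\in X$, and $E$ is $N_{|\tau|}$ if $i=|\rho|-1$ and $M_{|\tau|}$ otherwise. **Theorem.**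 For every such $A_\infty$-action of $X$ on $P$, the space $P$ is a deformation retract of $B(X,X,P)$. Precisely: the maps $\iota:P\to B(X,X,P)$, $p\mapsto[\delta_2;e,p]$, and $r:B(X,X,P)\to P$, $[T;x_0,\dots,x_n,p]\mapsto N_{n+2}(T;x_0,\dots,x_n,p)$, are well defined and continuous, $r\circ\iota=\mathrm{id}_P$, and $\iota\circ r$ is homotopic to the identity of $B(X,X,P)$. -/

import Mathlib

open Topology

/-! ### Metric trees

Leaves of a planar rooted tree with `n` leaves are numbered `0, …, n - 1` from left to right.
If every vertex has at least two incoming edges, the tree is determined by its internal edges,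
and an internal edge is determined by the set of leaves lying above it: an interval
`{a, …, b - 1}` with at least two elements which is not the set of all leaves.
A set of such intervals comes from a tree if and only if any two of them are nested or disjoint. -/

/-- `{a, …, b - 1}` can be the set of leaves above an internal edge of a tree with `n` leaves. -/
def IsEdge (n a b : ℕ) : Prop := a + 2 ≤ b ∧ b ≤ n ∧ b < a + n

instance (n a b : ℕ) : Decidable (IsEdge n a b) := inferInstanceAs (Decidable (_ ∧ _ ∧ _))

/-- The intervals `{a, …, b - 1}` and `{c, …, d - 1}` are disjoint or nested. -/
def Laminar (a b c d : ℕ) : Prop := b ≤ c ∨ d ≤ a ∨ (a ≤ c ∧ d ≤ b) ∨ (c ≤ a ∧ b ≤ d)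

/-- A planar tree with `n` leaves, all of whose vertices have at least two incoming edges,
given by its internal edges. -/
structure PlanarTree (n : ℕ) where
  edges : Finset (ℕ × ℕ)
  isEdge : ∀ e ∈ edges, IsEdge n e.1 e.2
  laminar : ∀ e ∈ edges, ∀ f ∈ edges, Laminar e.1 e.2 f.1 f.2

/-- Edge-labeled trees with `n` leaves, with the topology of the disjoint union of the cubes
`[0,1]^{i(T)}`. -/
abbrev EdgeLabeledTree (n : ℕ) : Type := Σ T : PlanarTree n, (T.edges → unitInterval)

/-- The tree obtained by collapsing the internal edge `e`. -/
def PlanarTree.collapse {n : ℕ} (T : PlanarTree n) (e : ℕ × ℕ) : PlanarTree n where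
  edges := T.edges.erase e
  isEdge f hf := T.isEdge f (Finset.mem_of_mem_erase hf)
  laminar f hf g hg := T.laminar f (Finset.mem_of_mem_erase hf) g (Finset.mem_of_mem_erase hg)

/-- An edge-labeled tree is identified with the one obtained by collapsing an edge of length `0`. -/
inductive CollapseRel (n : ℕ) : EdgeLabeledTree n → EdgeLabeledTree n → Prop
  | collapse (T : PlanarTree n) (l : T.edges → unitInterval) (e : T.edges) (he : l e = 0) :
      CollapseRel n ⟨T, l⟩
        ⟨T.collapse e.1, fun f => l ⟨f.1, Finset.mem_of_mem_erase f.2⟩⟩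

/-- The space `K_n` of metric trees with `n` leaves. A class of edge-labeled trees modulo collapsing
of edges of length `0` is recorded by the length of each interval (`0` if it is not an edge).
The topology is that of pointwise convergence of the lengths. By `metricTreeHomeo` below, this is
the quotient of the space of edge-labeled trees by the above relation. -/
structure MetricTree (n : ℕ) where
  len : ℕ → ℕ → ℝ
  nonneg : ∀ a b, 0 ≤ len a b
  le_one : ∀ a b, len a b ≤ 1
  isEdge : ∀ a b, len a b ≠ 0 → IsEdge n a b
  laminar : ∀ a b c d, len a b ≠ 0 → len c d ≠ 0 → Laminar a b c d

namespace MetricTree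

@[ext]
theorem ext' {n : ℕ} {S T : MetricTree n} (h : ∀ a b, S.len a b = T.len a b) : S = T := by
  cases S; cases T; congr; funext a b; exact h a b

instance (n : ℕ) : TopologicalSpace (MetricTree n) := .induced MetricTree.len inferInstance

/-- The corolla `δ_n`, without internal edges (for `n = 1` the trivial tree). -/
def corolla (n : ℕ) : MetricTree n where
  len _ _ := 0
  nonneg _ _ := le_rfl
  le_one _ _ := zero_le_one
  isEdge _ _ h := absurd rfl h
  laminar _ _ _ _ h := absurd rfl h

/-- The lengths of `ρ ∘_i τ`, where `τ` has `m` leaves, which become the leaves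
`i, …, i + m - 1`. The new edge has length `1`. Outside of `τ`, the length of an interval is the
maximum of the lengths of the (at most one if `m ≥ 1`, at most two if `m = 0`) intervals of leaves
of `ρ` which become this interval when leaf `i` is replaced by `m` leaves. For `m = 0` this is
erasing the leaf `i`: if a vertex with one incoming edge is left, it is erased too and the lengths
`α`, `β` of the two edges at it are replaced by `max α β`. -/
noncomputable def graftLen (m i : ℕ) (ρ τ : ℕ → ℕ → ℝ) (a b : ℕ) : ℝ :=
  if i ≤ a ∧ b ≤ i + m then
    (if a = i ∧ b = i + m then 1 else τ (a - i) (b - i))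
  else
    max (if b ≤ i then ρ a b else 0)
      (max (if i + m ≤ a then ρ (a + 1 - m) (b + 1 - m) else 0)
        (if a ≤ i ∧ i + m ≤ b then ρ a (b + 1 - m) else 0))

theorem graftLen_cases {m i : ℕ} {ρ τ : ℕ → ℕ → ℝ} {a b : ℕ} (h : graftLen m i ρ τ a b ≠ 0) :
    (i = a ∧ b = i + m) ∨ (i ≤ a ∧ b ≤ i + m ∧ τ (a - i) (b - i) ≠ 0) ∨
    (b ≤ i ∧ ρ a b ≠ 0) ∨ (i + m ≤ a ∧ ρ (a + 1 - m) (b + 1 - m) ≠ 0) ∨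
    (a ≤ i ∧ i + m ≤ b ∧ ρ a (b + 1 - m) ≠ 0) := by
  by_contra hc
  push Not at hc
  obtain ⟨h1, h2, h3, h4, h5⟩ := hc
  apply h
  unfold graftLen
  split_ifs <;> grind

/-- The operadic composition `ρ ∘_i τ` of metric trees: the root of `τ` is grafted to the leaf `i`
of `ρ`, the new edge having length `1`. The number `k` of leaves of the result is `n + m - 1`.
For `m = 0` the leaf `i` is erased, and for `m = 1` or `n = 1` this is the other tree. -/
noncomputable def graft {n m k : ℕ} (_h : k + 1 = n + m) (ρ : MetricTree n) (i : Fin n)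
    (τ : MetricTree m) : MetricTree k where
  len a b := if IsEdge k a b then graftLen m i ρ.len τ.len a b else 0
  nonneg a b := by
    have h1 := ρ.nonneg
    have h2 := τ.nonneg
    unfold graftLen
    split_ifs <;> simp [h1, h2]
  le_one a b := by
    have h1 := ρ.le_one
    have h2 := τ.le_one
    unfold graftLen
    split_ifs <;> simp [h1, h2]
  isEdge a b hab := by
    by_contra hc
    simp [hc] at hab
  laminar a b c d hab hcd := by
    have hE : IsEdge k a b := by
      by_contra hc
      simp [hc] at hab
    have hF : IsEdge k c d := by
      by_contra hc
      simp [hc] at hcd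
    rw [if_pos hE] at hab
    rw [if_pos hF] at hcd
    have hi := i.2
    unfold IsEdge at hE hF
    rcases graftLen_cases hab with hab | hab | hab | hab | hab <;>
    rcases graftLen_cases hcd with hcd | hcd | hcd | hcd | hcd <;>
    unfold Laminar <;>
    first
      | omega
      | (have h3 := ρ.laminar _ _ _ _ hab.2 hcd.2; unfold Laminar at h3; omega)
      | (have h3 := ρ.laminar _ _ _ _ hab.2.2 hcd.2; unfold Laminar at h3; omega)
      | (have h3 := ρ.laminar _ _ _ _ hab.2 hcd.2.2; unfold Laminar at h3; omega)
      | (have h3 := ρ.laminar _ _ _ _ hab.2.2 hcd.2.2; unfold Laminar at h3; omega)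
      | (have h3 := τ.laminar _ _ _ _ hab.2.2 hcd.2.2; unfold Laminar at h3; omega)

end MetricTree

/-! ### The comparison with the quotient of the space of edge-labeled trees -/

/-- Extension of an edge-labeling by `0`. -/
noncomputable def EdgeLabeledTree.toMetricTree {n : ℕ} (T : EdgeLabeledTree n) : MetricTree n where
  len a b := if h : (a, b) ∈ T.1.edges then (T.2 ⟨(a, b), h⟩ : ℝ) else 0
  nonneg a b := by
    split_ifs
    · exact (T.2 _).2.1
    · exact le_rfl
  le_one a b := by
    split_ifs
    · exact (T.2 _).2.2
    · exact zero_le_one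
  isEdge a b h := by
    by_cases hab : (a, b) ∈ T.1.edges
    · exact T.1.isEdge _ hab
    · simp [hab] at h
  laminar a b c d h h' := by
    by_cases hab : (a, b) ∈ T.1.edges
    · by_cases hcd : (c, d) ∈ T.1.edges
      · exact T.1.laminar _ hab _ hcd
      · simp [hcd] at h'
    · simp [hab] at h

theorem EdgeLabeledTree.toMetricTree_eq_of_collapseRel {n : ℕ} {S T : EdgeLabeledTree n}
    (h : CollapseRel n S T) : S.toMetricTree = T.toMetricTree := by
  cases h with
  | collapse T l e he =>
    ext a b
    obtain ⟨⟨c, d⟩, hcd⟩ := e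
    by_cases hab : (a, b) ∈ T.edges
    · by_cases h2 : (a, b) = (c, d)
      · obtain ⟨rfl, rfl⟩ := Prod.mk.inj h2
        simp [toMetricTree, PlanarTree.collapse, hab, he]
      · simp [toMetricTree, PlanarTree.collapse, hab, h2]
    · simp [toMetricTree, PlanarTree.collapse, hab]

instance (n : ℕ) : Finite (PlanarTree n) := by
  have h : ∀ T : PlanarTree n,
      T.edges ∈ (Finset.range (n + 1) ×ˢ Finset.range (n + 1)).powerset := by
    intro T
    rw [Finset.mem_powerset]
    intro e he
    have := T.isEdge e he
    unfold IsEdge at this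
    simp only [Finset.mem_product, Finset.mem_range]
    omega
  refine Finite.of_injective (fun T => (⟨T.edges, h T⟩ :
    {E // E ∈ (Finset.range (n + 1) ×ˢ Finset.range (n + 1)).powerset})) fun S T hST => ?_
  have hE : S.edges = T.edges := congrArg Subtype.val hST
  cases S; cases T
  simp only at hE
  subst hE
  rfl

/-- Collapsing all edges of length `0` gives the reduced representative of a metric tree. -/
theorem EdgeLabeledTree.exists_reduced {n : ℕ} (T : EdgeLabeledTree n) :
    ∃ S : EdgeLabeledTree n, Quot.mk (CollapseRel n) T = Quot.mk (CollapseRel n) S ∧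
      ∀ e, S.2 e ≠ 0 := by
  induction hN : T.1.edges.card using Nat.strong_induction_on generalizing T with
  | _ N ih =>
    by_cases h : ∀ e, T.2 e ≠ 0
    · exact ⟨T, rfl, h⟩
    · push Not at h
      obtain ⟨e, he⟩ := h
      have hr := CollapseRel.collapse T.1 T.2 e he
      obtain ⟨S, hS, hS'⟩ := ih (T.1.edges.erase e.1).card
        (hN ▸ Finset.card_erase_lt_of_mem e.2)
        ⟨T.1.collapse e.1, fun f => T.2 ⟨f.1, Finset.mem_of_mem_erase f.2⟩⟩ rfl
      exact ⟨S, (Quot.sound hr).trans hS, hS'⟩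

theorem EdgeLabeledTree.eq_of_reduced {n : ℕ} {S T : EdgeLabeledTree n} (hS : ∀ e, S.2 e ≠ 0)
    (hT : ∀ e, T.2 e ≠ 0) (h : S.toMetricTree = T.toMetricTree) : S = T := by
  obtain ⟨⟨E, hE, hE'⟩, l⟩ := S
  obtain ⟨⟨F, hF, hF'⟩, l'⟩ := T
  have key : ∀ a b, (if h : (a, b) ∈ E then (l ⟨(a, b), h⟩ : ℝ) else 0) =
      if h : (a, b) ∈ F then (l' ⟨(a, b), h⟩ : ℝ) else 0 :=
    fun a b => congrFun (congrFun (congrArg MetricTree.len h) a) b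
  have hEF : E = F := by
    ext ⟨a, b⟩
    have hk := key a b
    constructor
    · intro hab
      by_contra hc
      rw [dif_pos hab, dif_neg hc] at hk
      exact hS ⟨(a, b), hab⟩ (Subtype.ext hk)
    · intro hab
      by_contra hc
      rw [dif_pos hab, dif_neg hc] at hk
      exact hT ⟨(a, b), hab⟩ (Subtype.ext hk.symm)
  subst hEF
  have hl : l = l' := by
    funext ⟨⟨a, b⟩, hab⟩
    have hk := key a b
    rw [dif_pos hab, dif_pos hab] at hk
    exact Subtype.ext hk
  subst hl
  rfl

theorem EdgeLabeledTree.continuous_toMetricTree (n : ℕ) :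
    Continuous (toMetricTree : EdgeLabeledTree n → MetricTree n) := by
  rw [continuous_induced_rng]
  refine continuous_pi fun a => continuous_pi fun b => continuous_sigma fun T => ?_
  change Continuous fun l : T.edges → unitInterval =>
    if h : (a, b) ∈ T.edges then (l ⟨(a, b), h⟩ : ℝ) else 0
  split_ifs with h
  · exact continuous_subtype_val.comp (continuous_apply _)
  · exact continuous_const

theorem EdgeLabeledTree.surjective_toMetricTree (n : ℕ) :
    Function.Surjective (toMetricTree : EdgeLabeledTree n → MetricTree n) := by
  classical
  intro T
  refine ⟨⟨⟨(Finset.range (n + 1) ×ˢ Finset.range (n + 1)).filter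
    (fun e => T.len e.1 e.2 ≠ 0), ?_, ?_⟩,
    fun e => ⟨T.len e.1.1 e.1.2, T.nonneg _ _, T.le_one _ _⟩⟩, ?_⟩
  · intro e he
    exact T.isEdge _ _ (Finset.mem_filter.mp he).2
  · intro e he f hf
    exact T.laminar _ _ _ _ (Finset.mem_filter.mp he).2 (Finset.mem_filter.mp hf).2
  · ext a b
    change (if h : _ then T.len a b else 0) = T.len a b
    split_ifs with h
    · rfl
    · by_contra hc
      have h0 : T.len a b ≠ 0 := fun h0 => hc h0.symm
      have h1 := T.isEdge a b h0
      unfold IsEdge at h1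
      apply h
      simp only [Finset.mem_filter, Finset.mem_product, Finset.mem_range]
      exact ⟨by omega, h0⟩

instance (n : ℕ) : T2Space (MetricTree n) :=
  T2Space.of_injective_continuous (f := MetricTree.len)
    (fun _ _ h => MetricTree.ext' fun a b => congrFun (congrFun h a) b) continuous_induced_dom

/-- `K_n` is the quotient of the space of edge-labeled trees with `n` leaves by the relation
generated by collapsing edges of length `0`. -/
noncomputable def metricTreeHomeo (n : ℕ) : Quot (CollapseRel n) ≃ₜ MetricTree n :=
  Continuous.homeoOfEquivCompactToT2
    (f := Equiv.ofBijective
      (Quot.lift EdgeLabeledTree.toMetricTree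
        fun _ _ h => EdgeLabeledTree.toMetricTree_eq_of_collapseRel h)
      ⟨by
        rintro ⟨S⟩ ⟨T⟩ h
        obtain ⟨S', hS, hS'⟩ := S.exists_reduced
        obtain ⟨T', hT, hT'⟩ := T.exists_reduced
        rw [hS, hT] at h ⊢
        exact congrArg _ (EdgeLabeledTree.eq_of_reduced hS' hT' h),
      fun T => by
        obtain ⟨S, hS⟩ := EdgeLabeledTree.surjective_toMetricTree n T
        exact ⟨Quot.mk _ S, hS⟩⟩)
    (continuous_quot_lift _ (EdgeLabeledTree.continuous_toMetricTree n))

/-! ### `A_∞`-spaces and `A_∞`-actions -/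

/-- For `x = (x_0, …, x_{k-1})` with `k = n + m - 1`, the `n`-tuple
`(x_0, …, x_{i-1}, f (x_i, …, x_{i+m-1}), x_{i+m}, …, x_{k-1})`. -/
def insertAt {X : Type*} {n m k : ℕ} (h : k + 1 = n + m) (i : Fin n) (f : (Fin m → X) → X)
    (x : Fin k → X) : Fin n → X := fun j =>
  if _ : j.1 < i.1 then x ⟨j.1, by omega⟩
  else if _ : j.1 = i.1 then f fun l => x ⟨i.1 + l.1, by omega⟩
  else x ⟨j.1 + m - 1, by omega⟩

/-- A (strictly unital) `A_∞`-space: an algebra over the operad `{K_n}_{n ≥ 0}` of metric trees.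
Products carry the compactly generated topology. -/
structure AInftySpace (X : Type*) [TopologicalSpace X] where
  /-- The structure maps `M_n : K_n × X^n → X`. -/
  M : (n : ℕ) → MetricTree n → (Fin n → X) → X
  continuous_M : ∀ n, Continuous fun y : CompactCoherentification (MetricTree n × (Fin n → X)) =>
    M n ((CompactCoherentification.mk _).symm y).1 ((CompactCoherentification.mk _).symm y).2
  M_one : ∀ (T : MetricTree 1) (x : Fin 1 → X), M 1 T x = x 0
  M_graft : ∀ {n m k : ℕ} (h : k + 1 = n + m) (ρ : MetricTree n) (i : Fin n) (τ : MetricTree m)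
    (x : Fin k → X), M k (ρ.graft h i τ) x = M n ρ (insertAt h i (M m τ) x)

/-- The unit `e_X = M_0(δ_0)`. -/
def AInftySpace.unit {X : Type*} [TopologicalSpace X] (A : AInftySpace X) : X :=
  A.M 0 (MetricTree.corolla 0) Fin.elim0

/-- A left `A_∞`-action of the `A_∞`-space `X` on `P`, in terms of its structure maps. -/
structure AInftyAction {X : Type*} [TopologicalSpace X] (A : AInftySpace X)
    (P : Type*) [TopologicalSpace P] where
  /-- `N n` is the structure map `N_{n+1} : K_{n+1} × X^n × P → P`. -/
  N : (n : ℕ) → MetricTree (n + 1) → (Fin n → X) → P → P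
  continuous_N : ∀ n, Continuous
    fun y : CompactCoherentification (MetricTree (n + 1) × (Fin n → X) × P) =>
      N n ((CompactCoherentification.mk _).symm y).1 ((CompactCoherentification.mk _).symm y).2.1
        ((CompactCoherentification.mk _).symm y).2.2
  N_one : ∀ (T : MetricTree 1) (x : Fin 0 → X) (p : P), N 0 T x p = p
  N_graft : ∀ {n m k : ℕ} (h : k + 1 = n + m) (ρ : MetricTree (n + 1)) (i : Fin n)
    (τ : MetricTree m) (x : Fin k → X) (p : P),
    N k (ρ.graft (k := k + 1) (by omega) i.castSucc τ) x p = N n ρ (insertAt h i (A.M m τ) x) p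
  N_graft_last : ∀ {n m : ℕ} (ρ : MetricTree (n + 1)) (τ : MetricTree (m + 1))
    (x : Fin (n + m) → X) (p : P),
    N (n + m) (ρ.graft (k := n + m + 1) (by omega) (Fin.last n) τ) x p =
      N n ρ (fun j => x (Fin.castAdd m j)) (N m τ (fun j => x (Fin.natAdd n j)) p)

/-! ### The two-sided bar construction -/

section Bar

variable {X : Type*} [TopologicalSpace X] {A : AInftySpace X} {P : Type*} [TopologicalSpace P]

/-- The coproduct over `n ≥ 0` of the spaces `K_{n+2} × X × X^n × P`, where products carry the
compactly generated topology. The `n + 1` points of `X` are `x_0, …, x_n`. -/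
abbrev BarData (X : Type*) [TopologicalSpace X] (P : Type*) [TopologicalSpace P] : Type _ :=
  Σ n : ℕ, CompactCoherentification (MetricTree (n + 2) × (Fin (n + 1) → X) × P)

/-- The point `(T; x_0, …, x_n, p)`. -/
noncomputable def BarData.mk (n : ℕ) (T : MetricTree (n + 2)) (x : Fin (n + 1) → X) (p : P) : BarData X P :=
  ⟨n, CompactCoherentification.mk _ (T, x, p)⟩

/-- The relation defining `B(X,X,P)`, where `X` acts on itself from the right by the maps `M_k`:
if the tree has an edge of length `1`, then the tree above it can be evaluated. -/
inductive BarRel (N : AInftyAction A P) : BarData X P → BarData X P → Prop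
  | left {n m k : ℕ} (h : k + 1 + 1 = n + 1 + m) (hm : 1 ≤ m) (ρ : MetricTree (n + 2))
      (i : Fin (n + 1)) (τ : MetricTree m) (x : Fin (k + 1) → X) (p : P) :
      BarRel N (BarData.mk k (ρ.graft (by omega) i.castSucc τ) x p)
        (BarData.mk n ρ (insertAt h i (A.M m τ) x) p)
  | last {n m : ℕ} (ρ : MetricTree (n + 2)) (τ : MetricTree (m + 1))
      (x : Fin (n + 1) → X) (y : Fin m → X) (p : P) :
      BarRel N
        (BarData.mk (n + m) (ρ.graft (by omega) (Fin.last (n + 1)) τ)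
          (fun j => Fin.append x y (Fin.cast (by omega) j)) p)
        (BarData.mk n ρ x (N.N m τ y p))

/-- The two-sided bar construction `B(X,X,P)` of the `A_∞`-action of `X` on `P`,
with the quotient topology. -/
def Bar (N : AInftyAction A P) : Type _ := Quot (BarRel N)

instance (N : AInftyAction A P) : TopologicalSpace (Bar N) :=
  inferInstanceAs (TopologicalSpace (Quot (BarRel N)))

/-- The class `[T; x_0, …, x_n, p]`. -/
noncomputable def Bar.mk (N : AInftyAction A P) {n : ℕ} (T : MetricTree (n + 2)) (x : Fin (n + 1) → X) (p : P) :
    Bar N := Quot.mk _ (BarData.mk n T x p)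

end Bar

/-!
Let `T` be a tree whose leaves are marked by `x_0, …, x_n, p`. Attach to `T` a new leaf, marked by the
unit `e`, on the left of its leftmost branch, and slide it along this branch from the root edge to
the edge at the leaf `0` (`MetricTree.slide`). This gives the homotopy (`Bar.slideHomotopy`).

* At the start the tree is `δ_2 ∘_1 T` (counting leaves from `0`). Its edge of length `1` can be
  evaluated, which gives `[δ_2; e, N(T; x_0, …, x_n, p)]` (`Bar.slideMk_of_nonpos`).
* At the end the tree is `T ∘_0 δ_2`. Evaluation of `δ_2` at `e, x_0` gives `x_0` since `e` is a
  strict unit, and the result is `[T; x_0, …, x_n, p]` (`Bar.slideMk_of_ge`).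

The homotopy has to be compatible with the evaluation of a subtree `τ` on an edge of length `1`. If
the new leaf is not attached to `τ`, it does not interfere with the evaluation
(`MetricTree.slide_graft`). If it is attached to `τ` (`MetricTree.slide_graft_zero`), its position is
forgotten by the evaluation: `e` is given by the operation `δ_0` which erases the leaf, and an edge
of length `l` is divided into parts of lengths `α`, `β` with `max α β = l`, so that erasing the new
leaf gives back `τ` (`MetricTree.slide_graft_corolla_zero`, `AInftySpace.M_slide_cons`). For the
evaluated tree, the slide is then already complete.

The total length of the leftmost branch is unbounded when the number of leaves varies, while the
position of the new leaf has to be a function of the time which does not depend on the tree. So it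
is `t / (1 - t)` at the time `t`, until the slide is certain to be complete (`slideTime`).

The homotopy is continuous on the bar construction because the unit interval is locally compact, so
that the product with it preserves quotient maps, and because it is compact, so that it does not
interact with the compactly generated topology (`CompactCoherentification.continuous_mk_uncurry`).
-/

/-! ### Basic facts on metric trees -/

namespace MetricTree

variable {n m k : ℕ}

theorem len_eq_zero (T : MetricTree n) {a b : ℕ} (h : ¬ IsEdge n a b) : T.len a b = 0 :=
  not_not.mp fun h' => h (T.isEdge a b h')

theorem continuous_len (a b : ℕ) : Continuous fun T : MetricTree n => T.len a b :=
  (continuous_apply b).comp ((continuous_apply a).comp continuous_induced_dom)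

instance : Subsingleton (MetricTree 1) :=
  ⟨fun S T => ext' fun a b => by
    have h : ¬ IsEdge 1 a b := by unfold IsEdge; omega
    rw [S.len_eq_zero h, T.len_eq_zero h]⟩

instance : Subsingleton (MetricTree 2) :=
  ⟨fun S T => ext' fun a b => by
    have h : ¬ IsEdge 2 a b := by unfold IsEdge; omega
    rw [S.len_eq_zero h, T.len_eq_zero h]⟩

theorem graft_one (h : n + 1 = n + 1) (T : MetricTree n) (i : Fin n) (τ : MetricTree 1) :
    T.graft h i τ = T := by
  ext a b
  change (if IsEdge n a b then graftLen 1 i T.len τ.len a b else 0) = _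
  split_ifs with hE
  · have hE' := hE
    unfold IsEdge at hE'
    have := T.nonneg a b
    unfold graftLen
    grind
  · rw [T.len_eq_zero hE]

/-! ### The leftmost branch of a metric tree -/

/-- The length of the edge of `T` above which the leaves `0, …, b - 1` lie, where the external
edges at the leaf `0` and at the root count as edges of length `1`. -/
noncomputable def branchLen (T : MetricTree n) (b : ℕ) : ℝ :=
  if b = 1 ∨ b = n then 1 else T.len 0 b

/-- Twice the total length of the edges of the leftmost branch of `T`, including the root edge,
which lie below those with leaves contained in `0, …, b - 1`. -/
noncomputable def branchPos (T : MetricTree n) (b : ℕ) : ℝ :=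
  2 * ∑ c ∈ Finset.Ioc b n, T.branchLen c

theorem branchLen_nonneg (T : MetricTree n) (b : ℕ) : 0 ≤ T.branchLen b := by
  unfold branchLen
  split_ifs
  exacts [zero_le_one, T.nonneg _ _]

theorem branchLen_le_one (T : MetricTree n) (b : ℕ) : T.branchLen b ≤ 1 := by
  unfold branchLen
  split_ifs
  exacts [le_rfl, T.le_one _ _]

theorem branchPos_eq_add (T : MetricTree n) {b : ℕ} (hb : b < n) :
    T.branchPos b = T.branchPos (b + 1) + 2 * T.branchLen (b + 1) := by
  unfold branchPos
  rw [← Finset.sum_Ioc_consecutive _ (Nat.le_succ b) hb, Nat.Ioc_succ_singleton,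
    Finset.sum_singleton]
  ring

theorem branchPos_antitone (T : MetricTree n) : Antitone T.branchPos := fun _ _ h =>
  mul_le_mul_of_nonneg_left (Finset.sum_le_sum_of_subset_of_nonneg
    (Finset.Ioc_subset_Ioc_left h) fun c _ _ => T.branchLen_nonneg c) zero_le_two

theorem branchPos_nonneg (T : MetricTree n) (b : ℕ) : 0 ≤ T.branchPos b :=
  mul_nonneg zero_le_two (Finset.sum_nonneg fun c _ => T.branchLen_nonneg c)

theorem branchPos_le (T : MetricTree n) (b : ℕ) : T.branchPos b ≤ 2 * (n - b : ℕ) := by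
  have := Finset.sum_le_card_nsmul (Finset.Ioc b n) T.branchLen 1 fun c _ => T.branchLen_le_one c
  unfold branchPos
  simp only [Nat.card_Ioc, nsmul_eq_mul, mul_one] at this
  linarith

theorem continuous_branchLen (b : ℕ) : Continuous fun T : MetricTree n => T.branchLen b := by
  unfold branchLen
  split_ifs
  exacts [continuous_const, continuous_len _ _]

theorem continuous_branchPos (b : ℕ) : Continuous fun T : MetricTree n => T.branchPos b :=
  continuous_const.mul (continuous_finsetSum _ fun c _ => continuous_branchLen c)

theorem branchLen_graft_of_le (h : k + 1 = n + m) (ρ : MetricTree n) {i : Fin n}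
    (τ : MetricTree m) (hm : 1 ≤ m) {b : ℕ} (hb : 1 ≤ b) (hbi : b ≤ i) :
    (ρ.graft h i τ).branchLen b = ρ.branchLen b := by
  have hi := i.2
  have := ρ.nonneg 0 b
  by_cases hb1 : b = 1
  · simp [branchLen, hb1]
  have hE : IsEdge k 0 b := by unfold IsEdge; omega
  simp only [branchLen, graft, graftLen, if_pos hE]
  grind

theorem branchLen_graft_of_lt (h : k + 1 = n + m) (ρ : MetricTree n) {i : Fin n}
    (τ : MetricTree m) {b : ℕ} (hi : 1 ≤ i.1) (hbi : i.1 < b) (hbm : b < i + m) :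
    (ρ.graft h i τ).branchLen b = 0 := by
  have := i.2
  have hE : IsEdge k 0 b := by unfold IsEdge; omega
  simp only [branchLen, graft, graftLen, if_pos hE]
  grind

theorem branchLen_graft_of_ge (h : k + 1 = n + m) (ρ : MetricTree n) {i : Fin n}
    (τ : MetricTree m) (hm : 1 ≤ m) {b : ℕ} (hb : i + m ≤ b) (hbk : b ≤ k) :
    (ρ.graft h i τ).branchLen b = ρ.branchLen (b + 1 - m) := by
  have hi := i.2
  have := ρ.nonneg 0 (b + 1 - m)
  by_cases hbk' : b = k
  · have : b + 1 - m = n := by omega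
    simp [branchLen, hbk', ← this]
  by_cases hb1 : b = 1
  · rw [show b + 1 - m = 1 by omega]
    simp [branchLen, hb1]
  have hE : IsEdge k 0 b := by unfold IsEdge; omega
  simp only [branchLen, graft, graftLen, if_pos hE]
  grind

theorem branchLen_graft_zero (h : k + 1 = n + m) (ρ : MetricTree n) {i : Fin n}
    (τ : MetricTree m) (hi : i.1 = 0) {b : ℕ} (hb : 1 ≤ b) (hbm : b ≤ m) :
    (ρ.graft h i τ).branchLen b = τ.branchLen b := by
  have := i.2
  by_cases hbk' : b = k
  · have : b = m := by omega
    simp [branchLen, hbk', ← this]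
  by_cases hb1 : b = 1
  · simp [branchLen, hb1]
  have hE : IsEdge k 0 b := by unfold IsEdge; omega
  simp only [branchLen, graft, graftLen, if_pos hE]
  grind

theorem branchPos_graft_of_ge (h : k + 1 = n + m) (ρ : MetricTree n) {i : Fin n}
    (τ : MetricTree m) (hm : 1 ≤ m) {b : ℕ} (hb : i + m ≤ b + 1) :
    (ρ.graft h i τ).branchPos b = ρ.branchPos (b + 1 - m) := by
  obtain ⟨d, rfl⟩ : ∃ d, m = d + 1 := ⟨m - 1, by omega⟩
  obtain ⟨c, rfl⟩ : ∃ c, b = c + d := ⟨b - d, by omega⟩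
  obtain rfl : k = n + d := by omega
  unfold branchPos
  rw [show c + d + 1 - (d + 1) = c by omega, ← Finset.map_add_right_Ioc, Finset.sum_map]
  congr 1
  refine Finset.sum_congr rfl fun j hj => ?_
  rw [Finset.mem_Ioc] at hj
  rw [addRightEmbedding_apply, branchLen_graft_of_ge h ρ τ hm (by omega) (by omega)]
  congr 1
  omega

theorem branchPos_graft_of_le (h : k + 1 = n + m) (ρ : MetricTree n) {i : Fin n}
    (τ : MetricTree m) (hm : 1 ≤ m) {b : ℕ} (hi : 1 ≤ i.1) (hb : b ≤ i) :
    (ρ.graft h i τ).branchPos b = ρ.branchPos b := by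
  have hi' := i.2
  have h1 := branchPos_graft_of_ge h ρ τ hm (i := i) (b := i + m - 1) (by omega)
  rw [show i + m - 1 + 1 - m = i by omega] at h1
  unfold branchPos at h1 ⊢
  rw [← Finset.sum_Ioc_consecutive _ (show b ≤ i by omega) (show i ≤ k by omega),
    ← Finset.sum_Ioc_consecutive _ (show i ≤ i + m - 1 by omega) (show i + m - 1 ≤ k by omega),
    ← Finset.sum_Ioc_consecutive _ (show b ≤ i by omega) (show i ≤ n by omega), mul_add, mul_add,
    mul_add, h1]
  rw [Finset.sum_eq_zero (s := Finset.Ioc i.1 (i + m - 1)), mul_zero, zero_add]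
  · congr 2
    refine Finset.sum_congr rfl fun j hj => ?_
    rw [Finset.mem_Ioc] at hj
    exact branchLen_graft_of_le h ρ τ hm (by omega) (by omega)
  · intro j hj
    rw [Finset.mem_Ioc] at hj
    exact branchLen_graft_of_lt h ρ τ hi (by omega) (by omega)

theorem branchPos_graft_zero (h : k + 1 = n + m) (ρ : MetricTree n) {i : Fin n}
    (τ : MetricTree m) (hm : 1 ≤ m) {b : ℕ} (hi : i.1 = 0) (hb : b ≤ m) :
    (ρ.graft h i τ).branchPos b = τ.branchPos b + ρ.branchPos 1 := by
  have hi' := i.2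
  have h1 := branchPos_graft_of_ge h ρ τ hm (i := i) (b := m) (by omega)
  rw [show m + 1 - m = 1 by omega] at h1
  rw [← h1]
  unfold branchPos
  rw [← Finset.sum_Ioc_consecutive _ hb (show m ≤ k by omega), mul_add]
  congr 2
  refine Finset.sum_congr rfl fun j hj => ?_
  rw [Finset.mem_Ioc] at hj
  exact branchLen_graft_zero h ρ τ hi (by omega) (by omega)

/-! ### Sliding a leaf along the leftmost branch -/

/-- The length of the interval `{a, …, b - 1}` in `T.slide u`. -/
noncomputable def slideLen (T : MetricTree n) (u : ℝ) (a b : ℕ) : ℝ :=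
  if a = 0 then min (T.branchLen (b - 1)) (max 0 (u - T.branchPos (b - 1)))
  else if a = 1 then min (T.branchLen (b - 1)) (max 0 (T.branchPos (b - 2) - u))
  else T.len (a - 1) (b - 1)

/-- The tree with `n + 1` leaves obtained by attaching a new leaf, which becomes the leaf `0`, to the
left of the leftmost branch of `T`, at the position `u`. The root edge and the edge at the leaf `0`
of `T` count as edges of length `1`. The new leaf divides an edge of length `l` into a lower part,
which lies below the leaves `0, …, b - 1`, and an upper part, which lies below `1, …, b - 1`. While
`u` runs through an interval of length `2 * l`, the length of the lower part increases from `0` to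
`l`, and then that of the upper part decreases from `l` to `0`; so the maximum of the two is `l`
throughout. -/
noncomputable def slide (T : MetricTree n) (u : ℝ) : MetricTree (n + 1) where
  len a b := if IsEdge (n + 1) a b then T.slideLen u a b else 0
  nonneg a b := by
    have := T.branchLen_nonneg (b - 1)
    have := T.nonneg (a - 1) (b - 1)
    unfold slideLen
    split_ifs <;> simp [*]
  le_one a b := by
    have := T.branchLen_le_one (b - 1)
    have := T.le_one (a - 1) (b - 1)
    unfold slideLen
    split_ifs <;> simp [*]
  isEdge a b hab := by
    by_contra hc
    simp [hc] at hab
  laminar := by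
    have key : ∀ a b c d, a ≤ c → (if IsEdge (n + 1) a b then T.slideLen u a b else 0) ≠ 0 →
        (if IsEdge (n + 1) c d then T.slideLen u c d else 0) ≠ 0 → Laminar a b c d := by
      intro a b c d hac hab hcd
      have hE : IsEdge (n + 1) a b := by
        by_contra hc
        simp [hc] at hab
      have hF : IsEdge (n + 1) c d := by
        by_contra hc
        simp [hc] at hcd
      rw [if_pos hE] at hab
      rw [if_pos hF] at hcd
      unfold IsEdge at hE hF
      unfold slideLen at hab hcd
      by_contra hL
      have hL' : a < c ∧ c < b ∧ b < d := by unfold Laminar at hL; omega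
      rw [if_neg (by omega)] at hcd
      by_cases hc1 : c = 1
      · -- The upper part of an edge is collapsed before the lower part of any edge above it grows.
        rw [if_pos (by omega)] at hab
        rw [if_pos hc1] at hcd
        have h1 := T.branchPos_antitone (show b - 1 ≤ d - 2 by omega)
        rcases le_total u (T.branchPos (b - 1)) with hu | hu
        · rw [max_eq_left (by linarith), min_eq_right (T.branchLen_nonneg _)] at hab
          exact hab rfl
        · rw [max_eq_left (by linarith), min_eq_right (T.branchLen_nonneg _)] at hcd
          exact hcd rfl
      · rw [if_neg hc1] at hcd
        have hab' : T.len (a - 1) (b - 1) ≠ 0 := by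
          by_cases ha : 2 ≤ a
          · rwa [if_neg (by omega), if_neg (by omega)] at hab
          · intro h0
            rw [show a - 1 = 0 by omega] at h0
            have : T.branchLen (b - 1) = 0 := by
              rw [branchLen, if_neg (by omega), h0]
            rw [this] at hab
            split_ifs at hab
            · simp at hab
            · simp at hab
            · omega
        have := T.laminar _ _ _ _ hab' hcd
        unfold Laminar at this
        omega
    intro a b c d hab hcd
    rcases le_total a c with h | h
    · exact key a b c d h hab hcd
    · have := key c d a b h hcd hab
      unfold Laminar at this ⊢
      omega

theorem slide_len (T : MetricTree n) (u : ℝ) {a b : ℕ} (h : IsEdge (n + 1) a b) :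
    (T.slide u).len a b = T.slideLen u a b := if_pos h

theorem slide_len_of_two_le (T : MetricTree n) (u : ℝ) {a b : ℕ} (h : 2 ≤ a) :
    (T.slide u).len a b = T.len (a - 1) (b - 1) := by
  by_cases hE : IsEdge (n + 1) a b
  · rw [slide_len T u hE, slideLen, if_neg (by omega), if_neg (by omega)]
  · rw [len_eq_zero _ hE, len_eq_zero]
    unfold IsEdge at hE ⊢
    omega

theorem continuous_slide : Continuous fun y : MetricTree n × ℝ => y.1.slide y.2 := by
  rw [continuous_induced_rng]
  refine continuous_pi fun a => continuous_pi fun b => ?_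
  change Continuous fun y : MetricTree n × ℝ =>
    if IsEdge (n + 1) a b then y.1.slideLen y.2 a b else 0
  have hl (c : ℕ) : Continuous fun y : MetricTree n × ℝ => y.1.branchLen c :=
    (continuous_branchLen c).comp continuous_fst
  have hp (c : ℕ) : Continuous fun y : MetricTree n × ℝ => y.1.branchPos c :=
    (continuous_branchPos c).comp continuous_fst
  unfold slideLen
  split_ifs
  · exact (hl _).min (continuous_const.max (continuous_snd.sub (hp _)))
  · exact (hl _).min (continuous_const.max ((hp _).sub continuous_snd))
  · exact (continuous_len _ _).comp continuous_fst
  · exact continuous_const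

/-- Suppose that `τ` is not grafted to the leaf `0`, or that `u` is at most the position at which the
lower part of the edge at the leaf `0` of `ρ` reaches length `1`. Then the new leaf is attached to
`ρ`. -/
theorem slide_graft (h : k + 1 = n + m) (h' : k + 1 + 1 = n + 1 + m) (ρ : MetricTree n)
    (i : Fin n) (τ : MetricTree m) (hm : 1 ≤ m) {u : ℝ} (hu : 1 ≤ i.1 ∨ u ≤ ρ.branchPos 1 + 1) :
    (ρ.graft h i τ).slide u = (ρ.slide u).graft h' i.succ τ := by
  have hi := i.2
  have hρ := (ρ.slide u).nonneg
  ext a b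
  by_cases hE : IsEdge (k + 1) a b
  swap
  · rw [len_eq_zero _ hE, len_eq_zero _ hE]
  change _ = if IsEdge (k + 1) a b then graftLen m (i.1 + 1) _ _ a b else 0
  rw [slide_len _ _ hE, if_pos hE, graftLen]
  unfold IsEdge at hE
  -- For `i = 0`, the point at which the leaf is attached does not reach the part from `τ`.
  have hlow : i.1 = 0 → ∀ c < m, u + 1 ≤ (ρ.graft h i τ).branchPos c := by
    intro hi0 c hc
    have h1 := (ρ.graft h i τ).branchPos_antitone (show c ≤ m - 1 by omega)
    have h2 := (ρ.graft h i τ).branchPos_eq_add (b := m - 1) (by omega)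
    rw [show m - 1 + 1 = m by omega, branchLen_graft_zero h ρ τ hi0 hm le_rfl,
      branchPos_graft_of_ge h ρ τ hm (b := m) (by omega), show m + 1 - m = 1 by omega, branchLen,
      if_pos (Or.inr rfl)] at h2
    have := hu.resolve_left (by omega)
    linarith
  obtain rfl | rfl | ha : a = 0 ∨ a = 1 ∨ 2 ≤ a := by omega
  · obtain ⟨c, rfl⟩ : ∃ c, b = c + 1 := ⟨b - 1, by omega⟩
    rw [if_neg (by omega), if_neg (show ¬ i.1 + 1 + m ≤ 0 by omega), slideLen, if_pos rfl]
    simp only [add_tsub_cancel_right, add_le_add_iff_right, zero_le, true_and]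
    obtain hc | ⟨hc1, hc2⟩ | hc : c ≤ i ∨ (i < c ∧ c < i + m) ∨ i + m ≤ c := by omega
    · rw [if_pos hc, if_neg (by omega), max_self, max_eq_left (hρ _ _),
        slide_len _ _ (by unfold IsEdge; omega), slideLen, if_pos rfl, add_tsub_cancel_right,
        branchLen_graft_of_le h ρ τ hm (by omega) hc,
        branchPos_graft_of_le h ρ τ hm (by omega) hc]
    · rw [if_neg (by omega), if_neg (by omega), max_self, max_self]
      by_cases hi0 : i.1 = 0
      · have := hlow hi0 c (by omega)
        rw [max_eq_left (by linarith), min_eq_right (branchLen_nonneg _ _)]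
      · rw [branchLen_graft_of_lt h ρ τ (by omega) hc1 hc2, min_eq_left (le_max_left _ _)]
    · rw [if_neg (by omega), if_pos (by omega), max_eq_right (hρ _ _), max_eq_right (hρ _ _),
        slide_len _ _ (by unfold IsEdge; omega), slideLen, if_pos rfl,
        branchLen_graft_of_ge h ρ τ hm hc (by omega),
        branchPos_graft_of_ge h ρ τ hm (by omega), show c + 1 + 1 - m - 1 = c + 1 - m by omega]
  · obtain ⟨c, rfl⟩ : ∃ c, b = c + 1 := ⟨b - 1, by omega⟩
    rw [if_neg (show ¬ i.1 + 1 + m ≤ 1 by omega), slideLen, if_neg one_ne_zero, if_pos rfl,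
      show c + 1 - 2 = c - 1 by omega]
    simp only [add_tsub_cancel_right]
    by_cases hc0 : i.1 = 0 ∧ c ≤ m
    · rw [if_pos (by omega), branchLen_graft_zero h ρ τ hc0.1 (by omega) hc0.2, min_eq_left]
      · by_cases hcm : c = m
        · rw [if_pos (by omega), branchLen, if_pos (Or.inr hcm)]
        · rw [if_neg (by omega), branchLen, if_neg (by omega)]
          congr 1 <;> omega
      · have := hlow hc0.1 (c - 1) (by omega)
        have := τ.branchLen_le_one c
        exact le_max_of_le_right (by linarith)
    rw [if_neg (by omega)]
    obtain hc | ⟨hc1, hc2⟩ | hc : c ≤ i ∨ (i < c ∧ c < i + m) ∨ i + m ≤ c := by omega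
    · rw [if_pos (by omega), if_neg (by omega), max_self, max_eq_left (hρ _ _),
        slide_len _ _ (by unfold IsEdge; omega), slideLen, if_neg one_ne_zero, if_pos rfl,
        show c + 1 - 2 = c - 1 by omega, add_tsub_cancel_right,
        branchLen_graft_of_le h ρ τ hm (by omega) hc,
        branchPos_graft_of_le h ρ τ hm (by omega) (by omega)]
    · rw [if_neg (by omega), if_neg (by omega), max_self, max_self,
        branchLen_graft_of_lt h ρ τ (by omega) hc1 hc2, min_eq_left (le_max_left _ _)]
    · rw [if_neg (by omega), if_pos (by omega), max_eq_right (hρ _ _), max_eq_right (hρ _ _),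
        slide_len _ _ (by unfold IsEdge; omega), slideLen, if_neg one_ne_zero, if_pos rfl,
        branchLen_graft_of_ge h ρ τ hm hc (by omega),
        branchPos_graft_of_ge h ρ τ hm (by omega), show c + 1 + 1 - m - 1 = c + 1 - m by omega,
        show c + 1 + 1 - m - 2 = c - 1 + 1 - m by omega]
  · rw [slideLen, if_neg (by omega), if_neg (by omega)]
    change (if IsEdge k (a - 1) (b - 1) then graftLen m i _ _ (a - 1) (b - 1) else 0) = _
    rw [if_pos (by unfold IsEdge; omega), graftLen, slide_len_of_two_le _ _ ha,
      slide_len_of_two_le _ _ ha]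
    by_cases h1 : i.1 + 1 ≤ a ∧ b ≤ i.1 + 1 + m
    · rw [if_pos h1, if_pos (by omega), show a - (i.1 + 1) = a - 1 - i by omega,
        show b - (i.1 + 1) = b - 1 - i by omega]
      congr 1
      apply propext
      omega
    · rw [if_neg h1, if_neg (by omega), show b + 1 - m - 1 = b - 1 + 1 - m by omega]
      congr 1
      · congr 1
        apply propext
        omega
      congr 1
      · by_cases h2 : i.1 + 1 + m ≤ a
        · rw [if_pos h2, if_pos (by omega), slide_len_of_two_le _ _ (by omega)]
          congr 1 <;> omega
        · rw [if_neg h2, if_neg (by omega)]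
      · congr 1
        apply propext
        omega

/-- Suppose that `τ` is grafted to the leaf `0` of `ρ`, and that `u` is at least the position at
which the lower part of the edge at this leaf reaches length `1`. Then the new leaf is attached to
`τ`, on an edge of length `1`. -/
theorem slide_graft_zero (h : k + 1 = n + m) (h' : k + 1 + 1 = n + (m + 1)) (ρ : MetricTree n)
    (i : Fin n) (τ : MetricTree m) (hm : 1 ≤ m) (hi : i.1 = 0) {u : ℝ}
    (hu : ρ.branchPos 1 + 1 ≤ u) :
    (ρ.graft h i τ).slide u = ρ.graft h' i (τ.slide (u - ρ.branchPos 1)) := by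
  have hi' := i.2
  have hρ := ρ.nonneg
  ext a b
  by_cases hE : IsEdge (k + 1) a b
  swap
  · rw [len_eq_zero _ hE, len_eq_zero _ hE]
  change _ = if IsEdge (k + 1) a b then graftLen (m + 1) i.1 _ _ a b else 0
  rw [slide_len _ _ hE, if_pos hE, graftLen, hi]
  unfold IsEdge at hE
  obtain ⟨c, rfl⟩ : ∃ c, b = c + 1 := ⟨b - 1, by omega⟩
  simp only [zero_le, true_and, zero_add, tsub_zero, add_le_add_iff_right, nonpos_iff_eq_zero]
  obtain rfl | rfl | ha : a = 0 ∨ a = 1 ∨ 2 ≤ a := by omega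
  · rw [slideLen, if_pos rfl, add_tsub_cancel_right]
    obtain hc | rfl | hc : c < m ∨ c = m ∨ m < c := by omega
    · rw [if_pos hc.le, if_neg (by omega), slide_len _ _ (by unfold IsEdge; omega), slideLen,
        if_pos rfl, add_tsub_cancel_right, branchLen_graft_zero h ρ τ hi (by omega) hc.le,
        branchPos_graft_zero h ρ τ hm hi hc.le]
      congr 2
      ring
    · rw [if_pos le_rfl, if_pos (by omega), branchLen_graft_zero h ρ τ hi (by omega) le_rfl,
        branchLen, if_pos (Or.inr rfl), branchPos_graft_of_ge h ρ τ hm (by omega),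
        show c + 1 - c = 1 by omega]
      exact min_eq_left (le_max_of_le_right (by linarith))
    · have h1 := ρ.branchPos_antitone (show 1 ≤ c + 1 - m by omega)
      have h2 := ρ.branchLen_le_one (c + 1 - m)
      rw [if_neg (by omega), if_neg (by omega), if_neg (by omega), if_pos (by omega),
        max_eq_right (hρ _ _), max_eq_right (hρ _ _),
        branchLen_graft_of_ge h ρ τ hm (by omega) (by omega),
        branchPos_graft_of_ge h ρ τ hm (by omega),
        min_eq_left (le_max_of_le_right (by linarith)), branchLen, if_neg (by omega),
        show c + 1 + 1 - (m + 1) = c + 1 - m by omega]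
  · rw [slideLen, if_neg one_ne_zero, if_pos rfl, add_tsub_cancel_right,
      show c + 1 - 2 = c - 1 by omega]
    by_cases hc : c ≤ m
    · rw [if_pos hc, if_neg (by omega), slide_len _ _ (by unfold IsEdge; omega), slideLen,
        if_neg one_ne_zero, if_pos rfl, add_tsub_cancel_right, show c + 1 - 2 = c - 1 by omega,
        branchLen_graft_zero h ρ τ hi (by omega) hc,
        branchPos_graft_zero h ρ τ hm hi (by omega)]
      congr 2
      ring
    · have h1 := ρ.branchPos_antitone (show 1 ≤ c - 1 + 1 - m by omega)
      rw [if_neg hc, if_neg (by omega), if_neg (by omega), if_neg (by omega), max_self, max_self,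
        branchPos_graft_of_ge h ρ τ hm (by omega), max_eq_left (by linarith),
        min_eq_right (branchLen_nonneg _ _)]
  · rw [slideLen, if_neg (by omega), if_neg (by omega)]
    change (if IsEdge k (a - 1) (c + 1 - 1) then graftLen m i _ _ (a - 1) (c + 1 - 1) else 0) = _
    rw [if_pos (by unfold IsEdge; omega), graftLen, slide_len_of_two_le _ _ ha, hi]
    simp only [zero_le, true_and, zero_add, tsub_zero, add_tsub_cancel_right]
    rw [show c + 1 + 1 - (m + 1) = c + 1 - m by omega,
      show a - 1 + 1 - m = a + 1 - (m + 1) by omega]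
    grind

/-- Erasing the new leaf gives back the tree: the two parts of length `α` and `β` of an edge of the
leftmost branch satisfy `max α β = l`, where `l` is the length of this edge. -/
theorem slide_graft_corolla_zero (h : m + 1 = m + 1 + 0) (τ : MetricTree m) (u : ℝ) :
    (τ.slide u).graft h 0 (corolla 0) = τ := by
  have hτ := τ.nonneg
  ext a b
  by_cases hE : IsEdge m a b
  swap
  · rw [len_eq_zero _ hE, len_eq_zero _ hE]
  change (if IsEdge m a b then graftLen 0 0 _ _ a b else 0) = _
  rw [if_pos hE, graftLen]
  unfold IsEdge at hE
  rw [if_neg (by omega), if_neg (by omega), if_pos (by omega),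
    max_eq_right (le_max_of_le_left (nonneg _ _ _)), Nat.sub_zero, Nat.sub_zero]
  by_cases ha : a = 0
  · subst ha
    have h1 := τ.branchPos_eq_add (b := b - 1) (by omega)
    rw [show b - 1 + 1 = b by omega] at h1
    have h2 := τ.branchLen_nonneg b
    rw [if_pos (by omega), slide_len _ _ (by unfold IsEdge; omega), slideLen,
      slide_len _ _ (by unfold IsEdge; omega), slideLen, if_neg (by omega), if_pos rfl,
      if_pos rfl, add_tsub_cancel_right, show b + 1 - 2 = b - 1 by omega,
      ← min_max_distrib_left, min_eq_left, branchLen, if_neg (by omega)]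
    rcases le_total u (τ.branchPos b + τ.branchLen b) with hu | hu
    · exact le_max_of_le_left (le_max_of_le_right (by linarith))
    · exact le_max_of_le_right (le_max_of_le_right (by linarith))
  · rw [if_neg (by omega), max_eq_left (nonneg _ _ _), slide_len_of_two_le _ _ (by omega)]
    rfl

/-- At the start the new leaf is attached below the root of `T`. -/
theorem slide_of_nonpos (h : n + 1 + 1 = 2 + n) (T : MetricTree n) {u : ℝ}
    (hu : u ≤ 0) : T.slide u = (corolla 2).graft h 1 T := by
  ext a b
  by_cases hE : IsEdge (n + 1) a b
  swap
  · rw [len_eq_zero _ hE, len_eq_zero _ hE]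
  change _ = if IsEdge (n + 1) a b then graftLen n 1 _ _ a b else 0
  rw [slide_len _ _ hE, if_pos hE, graftLen]
  unfold IsEdge at hE
  obtain ⟨c, rfl⟩ : ∃ c, b = c + 1 := ⟨b - 1, by omega⟩
  obtain rfl | rfl | ha : a = 0 ∨ a = 1 ∨ 2 ≤ a := by omega
  · have := T.branchPos_nonneg c
    rw [slideLen, if_pos rfl, add_tsub_cancel_right, max_eq_left (by linarith),
      min_eq_right (branchLen_nonneg _ _)]
    simp [corolla]
  · have h1 := T.branchPos_eq_add (b := c - 1) (by omega)
    have h2 := T.branchPos_nonneg (c - 1 + 1)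
    have h3 := T.branchLen_nonneg c
    rw [show c - 1 + 1 = c by omega] at h1 h2
    rw [slideLen, if_neg one_ne_zero, if_pos rfl, add_tsub_cancel_right,
      show c + 1 - 2 = c - 1 by omega, min_eq_left (le_max_of_le_right (by linarith)),
      if_pos (by omega), branchLen]
    have : c ≠ 1 := by omega
    simp [this, add_comm 1 n]
  · rw [slideLen, if_neg (by omega), if_neg (by omega), if_pos (by omega), if_neg (by omega)]

/-- At the end the new leaf is attached to the edge at the leaf `0` of `T`. -/
theorem slide_of_ge (h : n + 1 + 1 = n + 2) (T : MetricTree n) {i : Fin n} (hi : i.1 = 0) {u : ℝ}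
    (hu : T.branchPos 1 + 1 ≤ u) : T.slide u = T.graft h i (corolla 2) := by
  have h1 := slide_graft_zero (k := n) rfl h T i (corolla 1) le_rfl hi hu
  rw [graft_one] at h1
  rw [h1]
  congr 1
  exact Subsingleton.elim (α := MetricTree 2) _ _

theorem branchPos_one_add_one_le (T : MetricTree n) (hn : 1 ≤ n) :
    T.branchPos 1 + 1 ≤ 2 * n := by
  have h := T.branchPos_le 1
  rw [Nat.cast_sub hn, Nat.cast_one] at h
  linarith

end MetricTree

/-! ### Continuity and compactly generated products -/

section

variable {Y Z W : Type*} [TopologicalSpace Y] [TopologicalSpace Z] [TopologicalSpace W]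

/-- A continuous map `Y × W → Z` with `W` compact and locally compact stays continuous when `Y` and
`Z` carry the compactly generated topology. It is enough to see that its adjoint, a map to the space
of continuous maps on `W`, is continuous on compact subsets `K` of `Y`, and `K × W` is compact. -/
theorem CompactCoherentification.continuous_mk_uncurry [CompactSpace W] [LocallyCompactSpace W]
    {f : Y × W → Z} (hf : Continuous f) :
    Continuous fun y : CompactCoherentification Y × W =>
      CompactCoherentification.mk Z (f ((CompactCoherentification.mk Y).symm y.1, y.2)) := by
  have hK : ∀ K : Set Y, IsCompact K → Continuous fun y : K × W =>
      CompactCoherentification.mk Z (f (y.1.1, y.2)) := by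
    intro K hK
    have : CompactSpace K := isCompact_iff_compactSpace.mp hK
    rw [CompactCoherentification.continuous_rng_of_compactSpace]
    exact hf.comp (by fun_prop)
  have hy : ∀ y : Y, Continuous fun w : W => CompactCoherentification.mk Z (f (y, w)) :=
    fun y => (hK {y} isCompact_singleton).comp
      (continuous_const.prodMk continuous_id :
        Continuous fun w : W => ((⟨y, rfl⟩ : ({y} : Set Y)), w))
  let F : CompactCoherentification Y → C(W, CompactCoherentification Z) :=
    fun y => ⟨_, hy ((CompactCoherentification.mk Y).symm y)⟩
  have hF : Continuous F := by
    rw [CompactCoherentification.continuous_dom_iff]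
    intro K h
    rw [continuousOn_iff_continuous_domRestrict]
    exact ContinuousMap.continuous_of_continuous_uncurry _ (hK K h)
  exact ContinuousMap.continuous_uncurry_of_continuous ⟨F, hF⟩

end

/-! ### The speed of the slide -/

/-- The position at the time `t` of the leaf sliding along a tree with `n` leaves. It is
`min (t / (1 - t)) (2 * n)` for `t < 1` and `2 * n` for `t = 1`. At `2 * n` the slide is complete.
The speed at which the leaf moves until then may not depend on `n`, as the number of leaves is not
constant on the classes of the bar construction. -/
noncomputable def slideTime (n : ℕ) (t : unitInterval) : ℝ :=
  (t : ℝ) / max (1 - (t : ℝ)) (t / (2 * n))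

theorem slideTime_den_pos {n : ℕ} (hn : 1 ≤ n) (t : unitInterval) :
    0 < max (1 - (t : ℝ)) (t / (2 * n)) := by
  have hn' : (0 : ℝ) < n := by exact_mod_cast hn
  rcases t.2.2.lt_or_eq with h | h
  · exact lt_max_of_lt_left (by linarith)
  · rw [h]
    exact lt_max_of_lt_right (by positivity)

theorem continuous_slideTime {n : ℕ} (hn : 1 ≤ n) : Continuous (slideTime n) := by
  unfold slideTime
  refine Continuous.div (by fun_prop) ?_ fun t => (slideTime_den_pos hn t).ne'
  fun_prop

theorem slideTime_zero (n : ℕ) : slideTime n 0 = 0 := by simp [slideTime]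

theorem slideTime_one {n : ℕ} (hn : 1 ≤ n) : slideTime n 1 = 2 * n := by
  have hn' : (0 : ℝ) < n := by exact_mod_cast hn
  have : (0 : ℝ) ≤ 1 / (2 * n) := by positivity
  rw [slideTime, Set.Icc.coe_one, sub_self, max_eq_right this]
  field_simp

/-- The positions for trees with different numbers of leaves agree until the slide in the smaller tree
is complete. -/
theorem slideTime_eq_or_le {n k : ℕ} (hn : 1 ≤ n) (hk : n ≤ k) (t : unitInterval) :
    slideTime k t = slideTime n t ∨ (2 * n ≤ slideTime n t ∧ 2 * n ≤ slideTime k t) := by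
  have hn' : (0 : ℝ) < n := by exact_mod_cast hn
  have hk' : (n : ℝ) ≤ k := by exact_mod_cast hk
  have ht := t.2.1
  have hd := slideTime_den_pos hn t
  have hd' := slideTime_den_pos (hn.trans hk) t
  have hle : (t : ℝ) / (2 * k) ≤ t / (2 * n) := by gcongr
  unfold slideTime
  rcases le_total ((t : ℝ) / (2 * n)) (1 - t) with h | h
  · left
    rw [max_eq_left h, max_eq_left (hle.trans h)]
  · right
    rw [max_eq_right h] at hd ⊢
    rw [le_div_iff₀ hd, le_div_iff₀ hd']
    have h1 : 2 * (n : ℝ) * (t / (2 * n)) = t := by field_simp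
    refine ⟨h1.le, ?_⟩
    calc 2 * (n : ℝ) * max (1 - (t : ℝ)) (t / (2 * k)) ≤ 2 * n * (t / (2 * n)) := by
          gcongr
          exact max_le h hle
      _ = t := h1

theorem MetricTree.slide_slideTime {n k : ℕ} (hn : 1 ≤ n) (hk : n ≤ k) (T : MetricTree n)
    (t : unitInterval) : T.slide (slideTime n t) = T.slide (slideTime k t) := by
  rcases slideTime_eq_or_le hn hk t with h | ⟨h, h'⟩
  · rw [h]
  · have h1 := T.branchPos_one_add_one_le hn
    rw [T.slide_of_ge rfl (i := ⟨0, hn⟩) rfl (h1.trans h),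
      T.slide_of_ge rfl (i := ⟨0, hn⟩) rfl (h1.trans h')]

/-! ### Inserting the unit -/

section

variable {X : Type*}

theorem insertAt_zero_cons {n m k : ℕ} (h : k + 1 + 1 = n + (m + 1)) (h' : k + 1 = n + m)
    (i : Fin n) (hi : i.1 = 0) {f : (Fin (m + 1) → X) → X} {g : (Fin m → X) → X} {a : X}
    (hfg : ∀ y, f (Fin.cons a y) = g y) (x : Fin k → X) :
    insertAt h i f (Fin.cons a x) = insertAt h' i g x := by
  funext j
  unfold insertAt
  have hi' := i.2
  split_ifs with h1 h2
  · omega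
  · rw [← hfg]
    congr 1
    funext l
    refine Fin.cases ?_ (fun l => ?_) l
    · have : (⟨i.1 + (0 : Fin (m + 1)).1, by simp; omega⟩ : Fin (k + 1)) = 0 := by
        apply Fin.ext; simp [hi]
      rw [this]; rfl
    · have : (⟨i.1 + l.succ.1, by simp; omega⟩ : Fin (k + 1)) =
        Fin.succ ⟨i.1 + l.1, by omega⟩ := by
        apply Fin.ext; simp; omega
      rw [this]; rfl
  · have : (⟨j.1 + (m + 1) - 1, by omega⟩ : Fin (k + 1)) = Fin.succ ⟨j.1 + m - 1, by omega⟩ := by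
      apply Fin.ext; simp; omega
    rw [this]; rfl

theorem insertAt_succ_cons {n m k : ℕ} (h : k + 1 + 1 = n + 1 + m) (h' : k + 1 = n + m)
    (i : Fin n) (f : (Fin m → X) → X) (a : X) (x : Fin k → X) :
    insertAt h i.succ f (Fin.cons a x) = Fin.cons a (insertAt h' i f x) := by
  funext j
  refine Fin.cases ?_ (fun j => ?_) j
  · simp [insertAt]
  · have hj := j.2
    have hi := i.2
    simp only [insertAt, Fin.cons_succ, Fin.val_succ]
    split_ifs
    all_goals try omega
    · rfl
    · congr 1
      funext l
      have : (⟨i.1 + 1 + l.1, by omega⟩ : Fin (k + 1)) = Fin.succ ⟨i.1 + l.1, by omega⟩ := by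
        apply Fin.ext; simp; omega
      rw [this]; rfl
    · have : (⟨j.1 + 1 + m - 1, by omega⟩ : Fin (k + 1)) = Fin.succ ⟨j.1 + m - 1, by omega⟩ := by
        apply Fin.ext; simp; omega
      rw [this]; rfl

namespace AInftySpace

variable [TopologicalSpace X] (A : AInftySpace X)

/-- Inserting the unit erases the leaf of a tree. -/
theorem M_slide_cons {m : ℕ} (τ : MetricTree m) (u : ℝ) (y : Fin m → X) :
    A.M (m + 1) (τ.slide u) (Fin.cons A.unit y) = A.M m τ y := by
  conv_rhs => rw [← τ.slide_graft_corolla_zero rfl u, A.M_graft]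
  congr 1
  funext j
  refine Fin.cases ?_ (fun j => ?_) j
  · simp only [insertAt, unit, Fin.cons_zero]
    simp
    congr 1
    exact Subsingleton.elim _ _
  · simp [insertAt]

theorem M_corolla_two (y : Fin 1 → X) :
    A.M 2 (MetricTree.corolla 2) (Fin.cons A.unit y) = y 0 := by
  rw [← A.M_one (MetricTree.corolla 1) y, ← A.M_slide_cons (MetricTree.corolla 1) 0,
    Subsingleton.elim (MetricTree.corolla 2) ((MetricTree.corolla 1).slide 0)]

end AInftySpace

end

/-! ### The deformation of the bar construction -/

section Bar

variable {X : Type*} [TopologicalSpace X] {A : AInftySpace X} {P : Type*} [TopologicalSpace P]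
  (N : AInftyAction A P)

namespace Bar

theorem mk_graft_left {n m k : ℕ} (h : k + 1 + 1 = n + 1 + m) (h' : k + 2 + 1 = n + 2 + m)
    (hm : 1 ≤ m) (ρ : MetricTree (n + 2)) (i : Fin (n + 2)) (j : Fin (n + 1)) (hij : i = j.castSucc)
    (τ : MetricTree m) (x : Fin (k + 1) → X) (p : P) :
    mk N (ρ.graft h' i τ) x p = mk N ρ (insertAt h j (A.M m τ) x) p := by
  subst hij
  exact Quot.sound (BarRel.left h hm ρ j τ x p)

theorem mk_graft_last {n m k : ℕ} (hk : k = n + m) (h : k + 2 + 1 = n + 2 + (m + 1))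
    (ρ : MetricTree (n + 2)) (τ : MetricTree (m + 1)) (x : Fin (n + 1) → X) (y : Fin m → X)
    (z : Fin (k + 1) → X) (hz : z = fun j => Fin.append x y (Fin.cast (by omega) j)) (p : P) :
    mk N (ρ.graft h (Fin.last (n + 1)) τ) z p = mk N ρ x (N.N m τ y p) := by
  subst hk hz
  exact Quot.sound (BarRel.last ρ τ x y p)

theorem isQuotientMap_mk : IsQuotientMap (Quot.mk (BarRel N)) := isQuotientMap_quot_mk

/-- The retraction `[T; x_0, …, x_n, p] ↦ N_{n+2}(T; x_0, …, x_n, p)`. -/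
noncomputable def retraction : C(Bar N, P) where
  toFun := Quot.lift (fun z : BarData X P =>
      N.N (z.1 + 1) ((CompactCoherentification.mk _).symm z.2).1
        ((CompactCoherentification.mk _).symm z.2).2.1
        ((CompactCoherentification.mk _).symm z.2).2.2) (by
    intro _ _ hr
    cases hr with
    | left h hm ρ i τ x p => exact N.N_graft h ρ i τ x p
    | @last n m ρ τ x y p =>
      have key : ∀ (k : ℕ) (hk : k = n + 1 + m) (h : k + 1 + 1 = n + 2 + (m + 1)),
          N.N k (ρ.graft h (Fin.last (n + 1)) τ)
            (fun j => Fin.append x y (Fin.cast hk j)) p = N.N (n + 1) ρ x (N.N m τ y p) := by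
        rintro _ rfl h
        rw [N.N_graft_last]
        simp
      exact key (n + m + 1) (by omega) (by omega))
  continuous_toFun := continuous_quot_lift _ (continuous_sigma fun n => N.continuous_N (n + 1))

theorem retraction_mk {n : ℕ} (T : MetricTree (n + 2)) (x : Fin (n + 1) → X) (p : P) :
    retraction N (mk N T x p) = N.N (n + 1) T x p := rfl

/-- The inclusion `p ↦ [δ_2; e, p]`. -/
noncomputable def inclusion [CompactlyCoherentSpace P] : C(P, Bar N) where
  toFun p := mk N (MetricTree.corolla 2) (fun _ => A.unit) p
  continuous_toFun := by
    have h : Continuous fun p : P => (MetricTree.corolla 2, (fun _ : Fin 1 => A.unit), p) := by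
      fun_prop
    exact continuous_quot_mk.comp <| continuous_sigmaMk.comp <|
      (CompactCoherentification.continuous_map_of_continuous h).comp
        CompactCoherentification.continuous_mk

theorem inclusion_apply [CompactlyCoherentSpace P] (p : P) :
    inclusion N p = mk N (MetricTree.corolla 2) (fun _ => A.unit) p := rfl

theorem retraction_inclusion [CompactlyCoherentSpace P] (p : P) :
    retraction N (inclusion N p) = p := by
  rw [inclusion_apply, retraction_mk]
  have h := N.N_graft (n := 1) (m := 0) (k := 0) rfl (MetricTree.corolla 2) 0
    (MetricTree.corolla 0) Fin.elim0 p
  rw [N.N_one] at h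
  refine Eq.trans ?_ h.symm
  congr 1
  funext j
  obtain rfl : j = 0 := Fin.ext (by omega)
  simp only [insertAt, AInftySpace.unit]
  simp

/-- The point `[T'; e, x_0, …, x_n, p]`, where `T'` is obtained from `T` by attaching a leaf to the
leftmost branch at the position `u`. -/
noncomputable def slideMk {n : ℕ} (u : ℝ) (T : MetricTree (n + 2)) (x : Fin (n + 1) → X) (p : P) :
    Bar N := mk N (T.slide u) (Fin.cons A.unit x : Fin (n + 1 + 1) → X) p

/-- When the new leaf has arrived at the top of the leftmost branch, it forms with the leaf `0` a
subtree `δ_2` on an edge of length `1`, which is evaluated to `M_2(δ_2; e, x_0) = x_0`. -/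
theorem slideMk_of_ge {n : ℕ} {u : ℝ} (T : MetricTree (n + 2)) (hu : T.branchPos 1 + 1 ≤ u)
    (x : Fin (n + 1) → X) (p : P) : slideMk N u T x p = mk N T x p := by
  rw [slideMk, T.slide_of_ge rfl (i := 0) rfl hu]
  refine (mk_graft_left N (n := n) (k := n + 1) rfl rfl one_le_two T 0 0 rfl _ _ p).trans ?_
  congr 1
  rw [insertAt_zero_cons (m := 1) (g := fun y => y 0) _ rfl 0 rfl A.M_corolla_two]
  funext j
  refine Fin.cases ?_ (fun j => ?_) j
  · simp [insertAt]
  · simp [insertAt]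
    rfl

theorem slideMk_of_nonpos [CompactlyCoherentSpace P] {n : ℕ} {u : ℝ} (T : MetricTree (n + 2))
    (hu : u ≤ 0) (x : Fin (n + 1) → X) (p : P) :
    slideMk N u T x p = inclusion N (retraction N (mk N T x p)) := by
  rw [slideMk, T.slide_of_nonpos (by omega) hu, retraction_mk, inclusion_apply]
  exact mk_graft_last N (n := 0) (m := n + 1) (by omega) _ _ T _ x _ (by
    funext j
    refine Fin.cases ?_ (fun j => ?_) j
    · rfl
    · have : (Fin.cast (by omega) j.succ : Fin (0 + 1 + (n + 1))) = Fin.natAdd 1 j := by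
        apply Fin.ext; simp; omega
      rw [this, Fin.append_right]; rfl) p

theorem slideMk_graft_left {n m k : ℕ} (h : k + 1 + 1 = n + 1 + m) (hm : 1 ≤ m) (u : ℝ)
    (ρ : MetricTree (n + 2)) (i : Fin (n + 1)) (τ : MetricTree m) (x : Fin (k + 1) → X) (p : P) :
    slideMk N u (ρ.graft (k := k + 2) (by omega) i.castSucc τ) x p =
      slideMk N u ρ (insertAt h i (A.M m τ) x) p := by
  by_cases hu : 1 ≤ i.1 ∨ u ≤ ρ.branchPos 1 + 1
  · rw [slideMk, ρ.slide_graft (by omega) (by omega) _ τ hm hu]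
    refine (mk_graft_left N (n := n + 1) (k := k + 1) (by omega) _ hm _ _ i.succ rfl _ _ p).trans ?_
    rw [insertAt_succ_cons _ h]
    rfl
  · -- The new leaf has arrived in `τ`, where evaluation forgets its position.
    push Not at hu
    have hi : i.1 = 0 := by omega
    rw [slideMk, ρ.slide_graft_zero (by omega) (by omega) _ τ hm hi hu.2.le]
    refine (mk_graft_left N (k := k + 1) (by omega) _ (by omega) ρ _ i rfl _ _ p).trans ?_
    rw [insertAt_zero_cons _ h i hi (A.M_slide_cons τ _), slideMk_of_ge N ρ hu.2.le]

theorem slideMk_graft_last {n m : ℕ} (u : ℝ) (ρ : MetricTree (n + 2)) (τ : MetricTree (m + 1))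
    (x : Fin (n + 1) → X) (y : Fin m → X) (p : P) :
    slideMk N u (ρ.graft (k := n + m + 2) (by omega) (Fin.last (n + 1)) τ)
      (fun j => Fin.append x y (Fin.cast (by omega) j)) p =
      slideMk N u ρ x (N.N m τ y p) := by
  rw [slideMk, ρ.slide_graft (by omega) (by omega) _ τ (by omega) (Or.inl (by simp))]
  refine mk_graft_last N (n := n + 1) (k := n + m + 1) (by omega) _ _ τ _ y _ ?_ p
  funext j
  refine Fin.cases ?_ (fun j => ?_) j
  · have : (Fin.cast (by omega) (0 : Fin (n + m + 1 + 1)) : Fin (n + 1 + 1 + m)) =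
      Fin.castAdd m 0 := rfl
    rw [this, Fin.append_left]; rfl
  · simp only [Fin.cons_succ]
    have hj := j.2
    by_cases hjn : j.1 < n + 1
    · have h1 : (Fin.cast (by omega) j : Fin (n + 1 + m)) = Fin.castAdd m ⟨j.1, hjn⟩ := rfl
      have h2 : (Fin.cast (by omega) j.succ : Fin (n + 1 + 1 + m)) =
        Fin.castAdd m (Fin.succ ⟨j.1, hjn⟩) := rfl
      rw [h1, h2, Fin.append_left, Fin.append_left, Fin.cons_succ]
    · have h1 : (Fin.cast (by omega) j : Fin (n + 1 + m)) =
          Fin.natAdd (n + 1) ⟨j.1 - (n + 1), by omega⟩ := by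
        apply Fin.ext; simp; omega
      have h2 : (Fin.cast (by omega) j.succ : Fin (n + 1 + 1 + m)) =
          Fin.natAdd (n + 1 + 1) ⟨j.1 - (n + 1), by omega⟩ := by
        apply Fin.ext; simp; omega
      rw [h1, h2, Fin.append_right, Fin.append_right]

/-- The homotopy which slides a leaf marked by `e` up the leftmost branch, on representatives. -/
noncomputable def slideData (t : unitInterval) (z : BarData X P) : Bar N :=
  slideMk N (slideTime (z.1 + 2) t) ((CompactCoherentification.mk _).symm z.2).1
    ((CompactCoherentification.mk _).symm z.2).2.1 ((CompactCoherentification.mk _).symm z.2).2.2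

theorem slideData_eq_of_barRel (t : unitInterval) {z w : BarData X P} (h : BarRel N z w) :
    slideData N t z = slideData N t w := by
  cases h with
  | @left n m k h hm ρ i τ x p =>
    refine (slideMk_graft_left N h hm _ ρ i τ x p).trans ?_
    exact congrArg (fun S => mk N S _ _)
      (ρ.slide_slideTime (k := k + 2) (by omega) (by omega) t).symm
  | @last n m ρ τ x y p =>
    refine (slideMk_graft_last N _ ρ τ x y p).trans ?_
    exact congrArg (fun S => mk N S _ _)
      (ρ.slide_slideTime (k := n + m + 2) (by omega) (by omega) t).symm

theorem continuous_slideData :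
    Continuous fun z : BarData X P × unitInterval => slideData N z.2 z.1 := by
  rw [← Homeomorph.sigmaProdDistrib.symm.comp_continuous_iff']
  refine continuous_sigma fun n => ?_
  have h : Continuous fun y : (MetricTree (n + 2) × (Fin (n + 1) → X) × P) × unitInterval =>
      (y.1.1.slide (slideTime (n + 2) y.2),
        (Fin.cons A.unit y.1.2.1 : Fin (n + 1 + 1) → X), y.1.2.2) := by
    refine Continuous.prodMk (MetricTree.continuous_slide.comp
      ((by fun_prop : Continuous _).prodMk
        ((continuous_slideTime (by omega)).comp continuous_snd))) (Continuous.prodMk ?_ ?_)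
    · exact continuous_pi fun j => Fin.cases (by simpa using continuous_const)
        (fun j => by simp only [Fin.cons_succ]; fun_prop) j
    · fun_prop
  exact continuous_quot_mk.comp
    ((continuous_sigmaMk (σ := fun n : ℕ =>
      CompactCoherentification (MetricTree (n + 2) × (Fin (n + 1) → X) × P)) (i := n + 1)).comp
        (CompactCoherentification.continuous_mk_uncurry h))

/-- The homotopy which slides a leaf marked by `e` up the leftmost branch. -/
noncomputable def slideHomotopy [CompactlyCoherentSpace P] :
    ContinuousMap.Homotopy ((inclusion N).comp (retraction N)) (ContinuousMap.id (Bar N)) where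
  toFun y := Quot.lift (slideData N y.1) (fun _ _ => slideData_eq_of_barRel N y.1) y.2
  continuous_toFun :=
    (isQuotientMap_mk N).continuous_lift_prod_right
      ((continuous_slideData N).comp continuous_swap)
  map_zero_left := by
    rintro ⟨n, z⟩
    exact slideMk_of_nonpos N _ (slideTime_zero _).le _ _
  map_one_left := by
    rintro ⟨n, z⟩
    refine slideMk_of_ge N _ ?_ _ _
    rw [slideTime_one (by omega)]
    exact MetricTree.branchPos_one_add_one_le _ (by omega)

end Bar

end Bar

/-- For an `A_∞`-action of `X` on `P`, the space `P`, embedded into `B(X,X,P)` by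
`p ↦ [δ_2; e, p]`, is a deformation retract of `B(X,X,P)`, with retraction
`[T; x_0, …, x_n, p] ↦ N_{n+2}(T; x_0, …, x_n, p)`. -/
theorem mainTheorem4 {X : Type*} [TopologicalSpace X] [T2Space X] [CompactlyCoherentSpace X]
    {P : Type*} [TopologicalSpace P] [T2Space P] [CompactlyCoherentSpace P]
    (A : AInftySpace X) (N : AInftyAction A P) :
    ∃ (ι : C(P, Bar N)) (r : C(Bar N, P)),
      (∀ p : P, ι p = Bar.mk N (MetricTree.corolla 2) (fun _ => A.unit) p) ∧
      (∀ (n : ℕ) (T : MetricTree (n + 2)) (x : Fin (n + 1) → X) (p : P),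
        r (Bar.mk N T x p) = N.N (n + 1) T x p) ∧
      r.comp ι = ContinuousMap.id P ∧
      ContinuousMap.Homotopic (ContinuousMap.id (Bar N)) (ι.comp r) :=
  ⟨Bar.inclusion N, Bar.retraction N, Bar.inclusion_apply N, fun _ => Bar.retraction_mk N,
    ContinuousMap.ext (Bar.retraction_inclusion N), ⟨(Bar.slideHomotopy N).symm⟩⟩
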